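/- Let $\rho,\alpha,\beta,\gamma,o_2\in\mathbb R$ with $\gamma>0$ and $o_2>0$. For $0\le y\le x\le 1$ let $$k^a(x,y)=-o_2\,x\,\frac{I_1\big(\sqrt{o_2(x^2-y^2)}\big)}{\sqrt{o_2(x^2-y^2)}},\qquad \ell^a(x,y)=-o_2\,x\,\frac{J_1\big(\sqrt{o_2(x^2-y^2)}\big)}{\sqrt{o_2(x^2-y^2)}}$$ (extended continuously to $x=y$), where $I_1$ and $J_1$ are the modified Bessel function and the Bessel function of the first kind of order one. These are the solutions of $k^a_{xx}-k^a_{yy}=o_2k^a$ and $\ell^a_{xx}-\ell^a_{yy}=-o_2\ell^a$ with $k^a_y(x,0)=\ell^a_y(x,0)=0$ and $k^a(x,x)=\ell^a(x,x)=-\tfrac12 o_2x$. Let $\|k^a\|$ and $\|\ell^a\|$ be the induced norms, i.e. the operator norms on $L^2(0,1)$ of $f\mapsto\int_0^x k^a(x,y)f(y)\,dy$ and $f\mapsto\int_0^x \ell^a(x,y)f(y)\,dy$, and let $\|k^a_x(1,\cdot)\|$ be the $L^2(0,1)$ norm of $y\mapsto k^a_x(1,y)$. Consider the observation error dynamics $$e^w_t=e^w_{xx}-\rho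 e^w+\alpha e^v-\eta_1(x)e^w(1,t),\qquad 0=e^v_{xx}-\gamma e^v+\beta e^w,$$ $$e^w_x(0,t)=0,\quad e^w_x(1,t)=-\eta_2e^w(1,t),\quad e^v_x(0,t)=e^v_x(1,t)=0$$ on $0<x<1$, $t>0$, with output injections $\eta_1=0$ and $\eta_2=-k^a(1,1)=\tfrac12o_2$. If $$o_2+\rho>\frac{|\alpha||\beta|}{\gamma}(1+\|k^a\|)(1+\|\ell^a\|)+\frac{(1+\|\ell^a\|)^2\|k^a_x(1,\cdot)\|^2+2}{2},$$ then the error dynamics are exponentially stable on $L^2(0,1)$: for every initial state $e^w(\cdot,0)\in L^2(0,1)$ there is exactly one solution $(e^w,e^v)$ on $[0,\infty)$ (with $e^w$ continuous in $L^2(0,1)$ for $t\ge0$, differentiable in $L^2(0,1)$ and $H^2(0,1)$-valued for $t>0$, and $e^v$ being $H^2(0,1)$-valued and solving the elliptic problem for all $t\ge0$), and there are constants $M,\omega>0$, independent of the initial state, such that $$\|e^w(\cdot,t)\|_{L^2}+\|e^v(\cdot,t)\|_{L^2}\le M e^{-\omega t}\|e^w(\cdot,0)\|_{L^2}\qquad\text{for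 all }t\ge0.$$ The same conclusion holds if $$o_2+\rho>\Big(\frac{|\alpha||\beta|}{\gamma}+\frac{\|k^a_x(1,\cdot)\|^2}{2}\Big)\Big[1+\sqrt{\tfrac{o_2\pi}{2}}\,\big(\operatorname{erfi}\sqrt{\tfrac{o_2}{2}}\big)^{1/2}\big(\operatorname{erf}\sqrt{\tfrac{o_2}{2}}\big)^{1/2}\Big]^2+1,$$ where $\operatorname{erf}(x)=\frac{2}{\sqrt\pi}\int_0^xe^{-\xi^2}d\xi$ and $\operatorname{erfi}(x)=\frac{2}{\sqrt\pi}\int_0^xe^{\xi^2}d\xi$. -/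

import Mathlib

open MeasureTheory Set

namespace ParabolicElliptic

noncomputable section

/-! ### Bessel functions and the backstepping kernels -/

/-- Modified Bessel function of the first kind of order one. -/
def besselI1 (z : ℝ) : ℝ :=
  ∑' m : ℕ, (z / 2) ^ (2 * m + 1) / ((m.factorial : ℝ) * ((m + 1).factorial : ℝ))

/-- Bessel function of the first kind of order one. -/
def besselJ1 (z : ℝ) : ℝ :=
  ∑' m : ℕ, (-1) ^ m * (z / 2) ^ (2 * m + 1) / ((m.factorial : ℝ) * ((m + 1).factorial : ℝ))

/-- The entire function `F` with `I₁(z) / z = F(z²)` and `J₁(z) / z = F(-z²)` for `z ≠ 0`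
(see `besselI1_div` and `besselJ1_div`); it takes care of the removable singularity at `z = 0`. -/
def besselQuot (s : ℝ) : ℝ :=
  ∑' m : ℕ, (s / 4) ^ m / (2 * ((m.factorial : ℝ) * ((m + 1).factorial : ℝ)))

theorem besselI1_div {z : ℝ} (hz : z ≠ 0) : besselI1 z / z = besselQuot (z ^ 2) := by
  unfold besselI1 besselQuot
  rw [← tsum_div_const]
  refine tsum_congr fun m => ?_
  have h : (z / 2) ^ (2 * m + 1) = (z ^ 2 / 4) ^ m * (z / 2) := by
    rw [pow_succ, pow_mul]; congr 2; ring
  rw [h]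
  have h1 : (m.factorial : ℝ) ≠ 0 := by positivity
  have h2 : ((m + 1).factorial : ℝ) ≠ 0 := by positivity
  field_simp

theorem besselJ1_div {z : ℝ} (hz : z ≠ 0) : besselJ1 z / z = besselQuot (-z ^ 2) := by
  unfold besselJ1 besselQuot
  rw [← tsum_div_const]
  refine tsum_congr fun m => ?_
  have h : (-1) ^ m * (z / 2) ^ (2 * m + 1) = (-z ^ 2 / 4) ^ m * (z / 2) := by
    rw [pow_succ, pow_mul, ← mul_assoc, ← mul_pow]; congr 2; ring
  rw [h]
  have h1 : (m.factorial : ℝ) ≠ 0 := by positivity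
  have h2 : ((m + 1).factorial : ℝ) ≠ 0 := by positivity
  field_simp

theorem besselQuot_zero : besselQuot 0 = 1 / 2 := by
  unfold besselQuot
  rw [tsum_eq_single 0]
  · norm_num
  · intro m hm
    simp [hm]

/-- The kernel `kᵃ(x,y) = -c x I₁(√(c (x² - y²))) / √(c (x² - y²))`, i.e. the solution of
`k_yy - k_xx + c k = 0`, `k_y(x,0) = 0`, `k(x,x) = -c x / 2`. -/
def kernelK (c x y : ℝ) : ℝ := -c * x * besselQuot (c * (x ^ 2 - y ^ 2))

/-- The kernel `ℓᵃ(x,y) = -c x J₁(√(c (x² - y²))) / √(c (x² - y²))` of the inverse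
transformation, i.e. the solution of
`ℓ_xx - ℓ_yy + c ℓ = 0`, `ℓ_y(x,0) = 0`, `ℓ(x,x) = -c x / 2`. -/
def kernelL (c x y : ℝ) : ℝ := -c * x * besselQuot (-(c * (x ^ 2 - y ^ 2)))

theorem kernelK_eq {c x y : ℝ} (hc : 0 < c) (hy : 0 ≤ y) (hyx : y < x) :
    kernelK c x y =
      -c * x * (besselI1 (Real.sqrt (c * (x ^ 2 - y ^ 2))) / Real.sqrt (c * (x ^ 2 - y ^ 2))) := by
  have h : 0 < c * (x ^ 2 - y ^ 2) := mul_pos hc (by nlinarith)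
  rw [besselI1_div (Real.sqrt_pos.2 h).ne', Real.sq_sqrt h.le, kernelK]

theorem kernelL_eq {c x y : ℝ} (hc : 0 < c) (hy : 0 ≤ y) (hyx : y < x) :
    kernelL c x y =
      -c * x * (besselJ1 (Real.sqrt (c * (x ^ 2 - y ^ 2))) / Real.sqrt (c * (x ^ 2 - y ^ 2))) := by
  have h : 0 < c * (x ^ 2 - y ^ 2) := mul_pos hc (by nlinarith)
  rw [besselJ1_div (Real.sqrt_pos.2 h).ne', Real.sq_sqrt h.le, kernelL]

theorem kernelK_diag (c x : ℝ) : kernelK c x x = -(1 / 2) * c * x := by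
  simp only [kernelK, sub_self, mul_zero, besselQuot_zero]; ring

theorem kernelL_diag (c x : ℝ) : kernelL c x x = -(1 / 2) * c * x := by
  simp only [kernelL, sub_self, mul_zero, neg_zero, besselQuot_zero]; ring

/-! ### The state space and the norms -/

/-- The real Hilbert space `L²(0,1)`. -/
abbrev L2 : Type := Lp ℝ 2 (volume.restrict (Icc (0 : ℝ) 1))

/-- The `L²(0,1)` norm of a function. -/
def l2Norm (g : ℝ → ℝ) : ℝ := Real.sqrt (∫ x in (0 : ℝ)..1, g x ^ 2)

/-- The induced norm of a kernel `k` on the triangle `0 ≤ y ≤ x ≤ 1`: the operator norm on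
`L²(0,1)` of the Volterra operator `f ↦ (x ↦ ∫₀ˣ k(x,y) f(y) dy)`. -/
def inducedNorm (k : ℝ → ℝ → ℝ) : ℝ :=
  sInf {C : ℝ | 0 ≤ C ∧
    ∀ f : L2, l2Norm (fun x => ∫ y in (0 : ℝ)..x, k x y * f y) ≤ C * ‖f‖}

/-- `‖kᵃ_x(1,·)‖`, the `L²(0,1)` norm of `y ↦ ∂kᵃ/∂x (1,y)`. -/
def normKx (c : ℝ) : ℝ := l2Norm (fun y => deriv (fun x => kernelK c x y) 1)

def erf (x : ℝ) : ℝ := 2 / Real.sqrt Real.pi * ∫ ξ in (0 : ℝ)..x, Real.exp (-ξ ^ 2)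

def erfi (x : ℝ) : ℝ := 2 / Real.sqrt Real.pi * ∫ ξ in (0 : ℝ)..x, Real.exp (ξ ^ 2)

/-! ### The observation error dynamics -/

/-- `f ∈ H²(0,1)`, with continuously differentiable representative `u` on `[0,1]`, derivative
`u' = u₁` (absolutely continuous) and second derivative `f₂ ∈ L²(0,1)`. -/
structure IsH2 (f f₂ : L2) (u u₁ : ℝ → ℝ) : Prop where
  ae_eq : f =ᵐ[volume.restrict (Icc (0 : ℝ) 1)] u
  fst : ∀ x ∈ Icc (0 : ℝ) 1, u x = u 0 + ∫ y in (0 : ℝ)..x, u₁ y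
  snd : ∀ x ∈ Icc (0 : ℝ) 1, u₁ x = u₁ 0 + ∫ y in (0 : ℝ)..x, f₂ y

/-- `(w, v)`, as functions of time `t ≥ 0` with values in `L²(0,1)`, solve
`w_t = w_xx - ρ w + α v - η₁(x) w(1,t)`, `0 = v_xx - γ v + β w`,
`w_x(0,t) = 0`, `w_x(1,t) = -η₂ w(1,t)`, `v_x(0,t) = v_x(1,t) = 0`.
The state `w` is continuous for `t ≥ 0`, differentiable for `t > 0`, and `w(t)` is in `H²(0,1)`
for `t > 0`. -/
structure IsSolution (ρ α β γ : ℝ) (η₁ : L2) (η₂ : ℝ) (w v : ℝ → L2) : Prop where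
  cont : ContinuousOn w (Ici 0)
  parabolic : ∀ t : ℝ, 0 < t → ∃ (w₂ : L2) (u u₁ : ℝ → ℝ), IsH2 (w t) w₂ u u₁ ∧
    u₁ 0 = 0 ∧ u₁ 1 = -η₂ * u 1 ∧
    HasDerivAt w (w₂ - ρ • w t + α • v t - u 1 • η₁) t
  elliptic : ∀ t : ℝ, 0 ≤ t → ∃ (v₂ : L2) (u u₁ : ℝ → ℝ), IsH2 (v t) v₂ u u₁ ∧
    u₁ 0 = 0 ∧ u₁ 1 = 0 ∧
    0 = v₂ - γ • v t + β • w t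

/-- Every initial state `w(0) ∈ L²(0,1)` gives rise to exactly one solution on `[0,∞)`. -/
def WellPosed (ρ α β γ : ℝ) (η₁ : L2) (η₂ : ℝ) : Prop :=
  ∀ w₀ : L2, ∃ w v : ℝ → L2, IsSolution ρ α β γ η₁ η₂ w v ∧ w 0 = w₀ ∧
    ∀ w' v' : ℝ → L2, IsSolution ρ α β γ η₁ η₂ w' v' → w' 0 = w₀ →
      ∀ t : ℝ, 0 ≤ t → w' t = w t ∧ v' t = v t

/-- The system is well-posed on `L²(0,1)` and both states decay exponentially, uniformly with
respect to the initial state. -/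
def ExponentiallyStable (ρ α β γ : ℝ) (η₁ : L2) (η₂ : ℝ) : Prop :=
  WellPosed ρ α β γ η₁ η₂ ∧
  ∃ M ω : ℝ, 0 < M ∧ 0 < ω ∧
    ∀ w v : ℝ → L2, IsSolution ρ α β γ η₁ η₂ w v →
      ∀ t : ℝ, 0 ≤ t → ‖w t‖ + ‖v t‖ ≤ M * Real.exp (-ω * t) * ‖w 0‖

end

end ParabolicElliptic

/-! ### Power series bounds for the kernel derivative -/

namespace ParabolicElliptic

open Filter Topology

/-! Each of the two hypotheses already forces `ρ > |α||β|/γ`, so the error system decays by a direct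
energy estimate and no backstepping transformation is needed. Since `1 +` an induced norm and the
bracket with `erf`, `erfi` are at least one, each hypothesis gives `o₂ + ρ > |α||β|/γ + normKx o₂ ^
2 / 2 + 1`. The term `o₂` then cancels because `o₂ ≤ 1 + normKx o₂ ^ 2 / 2`
(`le_one_add_normKx_sq`), a consequence of the nonnegative Taylor coefficients of `besselQuot`.

Decay: with zero `η₁` and `η₂ ≥ 0`, integration by parts makes the boundary contribution `-η₂ w(1)²`
dissipative, and the elliptic equation gives `‖v‖ ≤ |β|/γ ‖w‖`. Hence `‖w‖` is bounded by `exp(-(ρ -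
|α||β|/γ) t) ‖w 0‖` (`IsSolution.norm_le`). This holds for either sign of the rate, so it also
yields uniqueness by linearity.

Existence: everything is expressed by the Volterra operator `V` on complex `L²(0,1)`, whose
integration by parts formula is `V + V* = ⟪1, ·⟫ 1`. The inverse of the Robin Laplacian and the
Neumann resolvent are explicit in `V` (`exists_robin_inverse`, `exists_neumann_resolvent`); after a
bounded perturbation and a spectral shift the generator is `-T⁻¹` with `T` nonnegative and
injective, and the continuous functional calculus of `T` supplies the semigroup
(`exists_semigroup_orbit`). Real parts give the real solution. -/

/-- The Taylor coefficients of `besselQuot`. -/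
noncomputable def besselCoeff (m : ℕ) : ℝ :=
  (1 / 4) ^ m / (2 * ((m.factorial : ℝ) * ((m + 1).factorial : ℝ)))

theorem besselCoeff_pos (m : ℕ) : 0 < besselCoeff m := by
  unfold besselCoeff; positivity

theorem besselCoeff_succ (m : ℕ) :
    besselCoeff (m + 1) = besselCoeff m * (1 / (4 * ((m + 1) * (m + 2)))) := by
  unfold besselCoeff
  rw [Nat.factorial_succ (m + 1), Nat.factorial_succ m]
  have h1 : (m.factorial : ℝ) ≠ 0 := by positivity
  push_cast
  field_simp
  ring

theorem besselQuot_eq_tsum (s : ℝ) : besselQuot s = ∑' m : ℕ, besselCoeff m * s ^ m := by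
  unfold besselQuot besselCoeff
  refine tsum_congr fun m => ?_
  rw [div_pow, div_pow, one_pow]
  field_simp

theorem radius_ofScalars_besselCoeff :
    (FormalMultilinearSeries.ofScalars ℝ besselCoeff).radius = ⊤ := by
  refine FormalMultilinearSeries.ofScalars_radius_eq_top_of_tendsto _ _
    (Eventually.of_forall fun n => (besselCoeff_pos n).ne') ?_
  have h : ∀ n : ℕ, ‖besselCoeff n.succ‖ / ‖besselCoeff n‖ ≤ 1 / ((n : ℝ) + 1) := by
    intro n
    have hn := besselCoeff_pos n
    rw [Real.norm_of_nonneg (besselCoeff_pos _).le, Real.norm_of_nonneg hn.le, Nat.succ_eq_add_one,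
      besselCoeff_succ, mul_div_cancel_left₀ _ hn.ne']
    apply one_div_le_one_div_of_le (by positivity)
    nlinarith [(Nat.cast_nonneg n : (0 : ℝ) ≤ n)]
  exact squeeze_zero (fun n => by positivity) h tendsto_one_div_add_atTop_nhds_zero_nat

theorem hasFPowerSeriesOnBall_besselQuot :
    HasFPowerSeriesOnBall besselQuot (FormalMultilinearSeries.ofScalars ℝ besselCoeff) 0 ⊤ := by
  have h := (FormalMultilinearSeries.ofScalars ℝ besselCoeff).hasFPowerSeriesOnBall
    (by rw [radius_ofScalars_besselCoeff]; simp)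
  rw [radius_ofScalars_besselCoeff] at h
  refine h.congr fun s _ => ?_
  rw [besselQuot_eq_tsum, FormalMultilinearSeries.sum]
  refine tsum_congr fun m => ?_
  simp [mul_comm]

theorem contDiff_besselQuot : ContDiff ℝ 1 besselQuot := by
  have h : AnalyticOnNhd ℝ besselQuot univ := by
    simpa using hasFPowerSeriesOnBall_besselQuot.analyticOnNhd
  exact contDiffOn_univ.1 h.contDiffOn_of_completeSpace

theorem hasSum_besselQuot (s : ℝ) :
    HasSum (fun m : ℕ => besselCoeff m * s ^ m) (besselQuot s) := by
  have h := hasFPowerSeriesOnBall_besselQuot.hasSum (y := s) (by simp)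
  simpa [mul_comm] using h

/-- All Taylor coefficients are positive, so the series compare term by term; the linear one, with
coefficient 1/16, produces the gain. -/
theorem besselQuot_add_le {s t : ℝ} (hs : 0 ≤ s) (hst : s ≤ t) :
    besselQuot s + (t - s) / 16 ≤ besselQuot t := by
  have h1 := (hasSum_besselQuot s).add (hasSum_ite_eq 1 ((t - s) / 16))
  refine hasSum_le (fun m => ?_) h1 (hasSum_besselQuot t)
  have hm : besselCoeff m * s ^ m ≤ besselCoeff m * t ^ m :=
    mul_le_mul_of_nonneg_left (pow_le_pow_left₀ hs hst m) (besselCoeff_pos m).le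
  by_cases h : m = 1
  · subst h
    simp [besselCoeff, Nat.factorial]
    linarith
  · simpa [h] using hm

theorem half_le_besselQuot {s : ℝ} (hs : 0 ≤ s) : 1 / 2 ≤ besselQuot s := by
  have := besselQuot_add_le le_rfl hs
  rw [besselQuot_zero] at this
  linarith

theorem le_deriv_besselQuot {s : ℝ} (hs : 0 ≤ s) : 1 / 16 ≤ deriv besselQuot s := by
  have hd : HasDerivAt besselQuot (deriv besselQuot s) s :=
    (contDiff_besselQuot.differentiable one_ne_zero s).hasDerivAt
  have h := (hasDerivAt_iff_tendsto_slope_left_right.1 hd).2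
  refine ge_of_tendsto h ?_
  filter_upwards [self_mem_nhdsWithin] with t ht
  have ht' : 0 < t - s := sub_pos.2 ht
  rw [slope_def_field, le_div_iff₀ ht']
  linarith [besselQuot_add_le hs (le_of_lt ht)]

theorem deriv_kernelK (c y : ℝ) :
    deriv (fun x => kernelK c x y) 1 =
      -(c * (besselQuot (c * (1 - y ^ 2)) + 2 * c * deriv besselQuot (c * (1 - y ^ 2)))) := by
  have hd : HasDerivAt besselQuot (deriv besselQuot (c * (1 ^ 2 - y ^ 2))) (c * (1 ^ 2 - y ^ 2)) :=
    (contDiff_besselQuot.differentiable one_ne_zero _).hasDerivAt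
  have h1 : HasDerivAt (fun x : ℝ => c * (x ^ 2 - y ^ 2)) (c * 2) 1 := by
    have := (((hasDerivAt_pow 2 (1 : ℝ)).sub_const (y ^ 2)).const_mul c)
    simpa using this
  have h2 : HasDerivAt (fun x : ℝ => -c * x) (-c) 1 := by
    simpa using (hasDerivAt_id (1 : ℝ)).const_mul (-c)
  have h3 := h2.mul (hd.comp (1 : ℝ) h1)
  have h4 : (fun x => kernelK c x y) =
      (fun x : ℝ => -c * x) * (besselQuot ∘ fun x : ℝ => c * (x ^ 2 - y ^ 2)) := rfl
  rw [h4, h3.deriv]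
  simp only [Function.comp_apply, one_pow]
  ring

/-- The bound is pointwise in `y`: the value of `besselQuot` contributes 1/2 and its derivative
contributes `2 * c / 16`. -/
theorem le_normKx_sq {c : ℝ} (hc : 0 < c) : (c * (1 / 2 + c / 8)) ^ 2 ≤ normKx c ^ 2 := by
  have hB : Continuous besselQuot := contDiff_besselQuot.continuous
  have hB' : Continuous (deriv besselQuot) := contDiff_besselQuot.continuous_deriv le_rfl
  unfold normKx l2Norm
  rw [Real.sq_sqrt (intervalIntegral.integral_nonneg zero_le_one fun _ _ => sq_nonneg _)]
  simp only [deriv_kernelK]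
  have h : ∫ _ in (0 : ℝ)..1, (c * (1 / 2 + c / 8)) ^ 2 = (c * (1 / 2 + c / 8)) ^ 2 := by simp
  rw [← h]
  refine intervalIntegral.integral_mono_on zero_le_one (by simp)
    (Continuous.intervalIntegrable (by fun_prop) _ _) fun y hy => ?_
  have hs : 0 ≤ c * (1 - y ^ 2) := mul_nonneg hc.le (by nlinarith [hy.1, hy.2])
  rw [neg_sq]
  refine pow_le_pow_left₀ (by positivity) (mul_le_mul_of_nonneg_left ?_ hc.le) 2
  nlinarith [half_le_besselQuot hs, le_deriv_besselQuot hs]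

theorem le_one_add_normKx_sq {c : ℝ} (hc : 0 < c) : c ≤ 1 + normKx c ^ 2 / 2 := by
  have h := le_normKx_sq hc
  -- The term `c / 8` is essential, since `1 + c ^ 2 / 8 - c` takes negative values. The inequality
  -- is nearly sharp around `c = 8 / 5`, which explains the squares supplied.
  have h2 : c ≤ 1 + (c * (1 / 2 + c / 8)) ^ 2 / 2 := by
    nlinarith [sq_nonneg (c ^ 2 - 5 / 2), sq_nonneg (c - 3 / 2), sq_nonneg (c - 8 / 5),
      mul_nonneg hc.le (sq_nonneg (c - 3 / 2)), mul_nonneg hc.le (sq_nonneg (c - 8 / 5))]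
  linarith

theorem inducedNorm_nonneg (k : ℝ → ℝ → ℝ) : 0 ≤ inducedNorm k :=
  Real.sInf_nonneg fun _ h => h.1

end ParabolicElliptic

/-! ### The Volterra operator on L²(0,1) -/

namespace ParabolicElliptic

section Volterra

variable {𝕜 : Type*} [RCLike 𝕜]

/-- Lebesgue measure on the unit interval. -/
noncomputable abbrev unitMeasure : Measure ℝ := volume.restrict (Icc (0 : ℝ) 1)

instance : IsProbabilityMeasure unitMeasure := ⟨by simp⟩

variable (𝕜) in
/-- The constant function `1` in `L²(0,1)`. -/
noncomputable def unitFun : Lp 𝕜 2 unitMeasure :=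
  indicatorConstLp 2 MeasurableSet.univ (measure_ne_top _ _) (1 : 𝕜)

theorem coeFn_unitFun : unitFun 𝕜 =ᵐ[unitMeasure] fun _ => (1 : 𝕜) := by
  refine indicatorConstLp_coeFn.trans (by simp)

theorem norm_unitFun : ‖unitFun 𝕜‖ = 1 := by
  rw [unitFun, norm_indicatorConstLp (by simp) (by simp)]
  simp

theorem integrable_of_L2 (f : Lp 𝕜 2 unitMeasure) : Integrable f unitMeasure :=
  (Lp.memLp f).integrable one_le_two

theorem intervalIntegrable_of_L2 (f : Lp 𝕜 2 unitMeasure) {a b : ℝ} (ha : a ∈ Icc (0 : ℝ) 1)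
    (hb : b ∈ Icc (0 : ℝ) 1) : IntervalIntegrable f volume a b := by
  rw [intervalIntegrable_iff]
  refine IntegrableOn.mono_set (integrable_of_L2 f) fun x hx => ?_
  rw [uIoc, mem_Ioc] at hx
  exact ⟨(le_min ha.1 hb.1).trans hx.1.le, hx.2.trans (max_le ha.2 hb.2)⟩

theorem intervalIntegral_eq_setIntegral (f : ℝ → 𝕜) {x : ℝ} (hx : x ∈ Icc (0 : ℝ) 1) :
    ∫ y in (0 : ℝ)..x, f y = ∫ y in Iic x, f y ∂unitMeasure := by
  rw [intervalIntegral.integral_of_le hx.1, ← integral_Icc_eq_integral_Ioc,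
    Measure.restrict_restrict measurableSet_Iic]
  congr 2
  ext y
  simp only [mem_Icc, mem_inter_iff, mem_Iic]
  constructor
  · rintro ⟨h1, h2⟩
    exact ⟨h2, h1, h2.trans hx.2⟩
  · rintro ⟨h1, h2, h3⟩
    exact ⟨h2, h1⟩

theorem inner_unitFun (f : Lp 𝕜 2 unitMeasure) :
    inner 𝕜 (unitFun 𝕜) f = ∫ y in (0 : ℝ)..1, f y := by
  rw [unitFun, L2.inner_indicatorConstLp_one, setIntegral_univ,
    intervalIntegral.integral_of_le zero_le_one, ← integral_Icc_eq_integral_Ioc]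

/-- Cauchy–Schwarz against the indicator of `Iic x`, whose norm is at most one in a probability
space. -/
theorem norm_setIntegral_Iic_le (f : Lp 𝕜 2 unitMeasure) (x : ℝ) :
    ‖∫ y in Iic x, f y ∂unitMeasure‖ ≤ ‖f‖ := by
  rw [← L2.inner_indicatorConstLp_one measurableSet_Iic (measure_ne_top _ _)]
  refine (norm_inner_le_norm _ _).trans ?_
  refine mul_le_of_le_one_left (norm_nonneg _) ?_
  rw [norm_indicatorConstLp (by simp) (by simp), norm_one, one_mul]
  exact Real.rpow_le_one measureReal_nonneg measureReal_le_one (by simp)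

theorem continuousOn_primitive_L2 (f : Lp 𝕜 2 unitMeasure) :
    ContinuousOn (fun x => ∫ y in (0 : ℝ)..x, f y) (Icc 0 1) := by
  have h := intervalIntegral.continuousOn_primitive_interval (a := (0 : ℝ)) (b := 1) (μ := volume)
    (f := f) (by rw [uIcc_of_le zero_le_one]; exact integrable_of_L2 f)
  rwa [uIcc_of_le zero_le_one] at h

theorem memLp_primitive (f : Lp 𝕜 2 unitMeasure) :
    MemLp (fun x => ∫ y in (0 : ℝ)..x, f y) 2 unitMeasure := by
  refine MemLp.of_bound ((continuousOn_primitive_L2 f).aestronglyMeasurable measurableSet_Icc)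
    ‖f‖ ?_
  filter_upwards [ae_restrict_mem measurableSet_Icc] with x hx
  rw [intervalIntegral_eq_setIntegral _ hx]
  exact norm_setIntegral_Iic_le f x

variable (𝕜) in
/-- The Volterra operator `f ↦ ∫₀ˣ f(y) dy` on `L²(0,1)`. -/
noncomputable def volterra : Lp 𝕜 2 unitMeasure →L[𝕜] Lp 𝕜 2 unitMeasure :=
  LinearMap.mkContinuous
    { toFun := fun f => (memLp_primitive f).toLp _
      map_add' := fun f g => by
        rw [← MemLp.toLp_add, MemLp.toLp_eq_toLp_iff]
        filter_upwards [ae_restrict_mem measurableSet_Icc] with x hx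
        rw [Pi.add_apply, intervalIntegral_eq_setIntegral _ hx, intervalIntegral_eq_setIntegral _ hx,
          intervalIntegral_eq_setIntegral _ hx,
          ← integral_add (integrable_of_L2 f).integrableOn (integrable_of_L2 g).integrableOn]
        exact integral_congr_ae (ae_restrict_of_ae (Lp.coeFn_add f g))
      map_smul' := fun c f => by
        rw [RingHom.id_apply, ← MemLp.toLp_const_smul, MemLp.toLp_eq_toLp_iff]
        filter_upwards [ae_restrict_mem measurableSet_Icc] with x hx
        rw [Pi.smul_apply, intervalIntegral_eq_setIntegral _ hx,
          intervalIntegral_eq_setIntegral _ hx, ← integral_smul]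
        exact integral_congr_ae (ae_restrict_of_ae (Lp.coeFn_smul c f)) } 1 fun f => by
    rw [one_mul]
    refine (Lp.norm_le_of_ae_bound (norm_nonneg f) ?_).trans_eq
      (by simp [measureUnivNNReal] : _ = ‖f‖)
    filter_upwards [(memLp_primitive f).coeFn_toLp, ae_restrict_mem measurableSet_Icc] with x hx hx'
    simp only [LinearMap.coe_mk, AddHom.coe_mk]
    rw [hx, intervalIntegral_eq_setIntegral _ hx']
    exact norm_setIntegral_Iic_le f x

theorem coeFn_volterra (f : Lp 𝕜 2 unitMeasure) :
    volterra 𝕜 f =ᵐ[unitMeasure] fun x => ∫ y in (0 : ℝ)..x, f y :=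
  (memLp_primitive f).coeFn_toLp

/-- A primitive that vanishes almost everywhere vanishes on all of [0,1] by continuity, and Lebesgue
differentiation recovers the integrand. -/
theorem volterra_injective : Function.Injective (volterra 𝕜) := by
  rw [injective_iff_map_eq_zero]
  intro f hf
  have h1 : (fun x => ∫ y in (0 : ℝ)..x, f y) =ᵐ[unitMeasure] fun _ => 0 := by
    refine (coeFn_volterra f).symm.trans ?_
    rw [hf]
    exact Lp.coeFn_zero _ _ _
  have h2 : EqOn (fun x => ∫ y in (0 : ℝ)..x, f y) (fun _ => 0) (Icc 0 1) :=
    Measure.eqOn_Icc_of_ae_eq volume zero_ne_one h1 (continuousOn_primitive_L2 f) continuousOn_const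
  have h3 := (intervalIntegrable_of_L2 f (a := 0) (b := 1) (by simp)
    (by simp)).ae_hasDerivAt_integral
  have h4 : ∀ᵐ x : ℝ, x ≠ 0 ∧ x ≠ 1 :=
    (Measure.ae_ne volume 0).and (Measure.ae_ne volume 1)
  have h5 : f =ᵐ[unitMeasure] fun _ => 0 := by
    rw [Filter.EventuallyEq, ae_restrict_iff' measurableSet_Icc]
    filter_upwards [h3, h4] with x hx hx4 hx'
    have h6 := hx (by rwa [uIcc_of_le zero_le_one]) 0 (by simp)
    have h7 : HasDerivAt (fun x => ∫ y in (0 : ℝ)..x, f y) 0 x := by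
      refine (hasDerivAt_const x (0 : 𝕜)).congr_of_eventuallyEq ?_
      filter_upwards [Icc_mem_nhds (lt_of_le_of_ne hx'.1 (Ne.symm hx4.1))
        (lt_of_le_of_ne hx'.2 hx4.2)] with y hy using h2 hy
    exact h6.unique h7
  exact (Lp.eq_zero_iff_ae_eq_zero).2 h5

/-- Integration by parts: the sum of the Volterra operator and its adjoint is `f ↦ ⟪1, f⟫ 1`. -/
theorem inner_volterra_add (f g : Lp 𝕜 2 unitMeasure) :
    inner 𝕜 (volterra 𝕜 f) g + inner 𝕜 f (volterra 𝕜 g) =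
      inner 𝕜 f (unitFun 𝕜) * inner 𝕜 (unitFun 𝕜) g := by
  have hf := integrable_of_L2 f
  have hg := integrable_of_L2 g
  have hcf : Integrable (fun x => starRingEnd 𝕜 (f x)) unitMeasure :=
    (RCLike.conjCLE (K := 𝕜)).toContinuousLinearMap.integrable_comp hf
  -- By Fubini the two inner products are integrals of `conj (f y) * g x` over the two triangles of
  -- the unit square, which overlap only in the null diagonal.
  set F : ℝ → ℝ → 𝕜 := fun x y => (Iic x).indicator (fun y => starRingEnd 𝕜 (f y) * g x) y with hF
  have hFi : Integrable (Function.uncurry F) (unitMeasure.prod unitMeasure) := by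
    have h1 : Integrable (fun z : ℝ × ℝ => g z.1 * starRingEnd 𝕜 (f z.2))
      (unitMeasure.prod unitMeasure) := hg.mul_prod hcf
    have h2 := h1.indicator (s := {z : ℝ × ℝ | z.2 ≤ z.1})
      (measurableSet_le measurable_snd measurable_fst)
    refine h2.congr (Filter.Eventually.of_forall fun z => ?_)
    simp only [Function.uncurry, hF, indicator, mem_Iic, mem_ofPred_eq, mul_comm]
  have e1 : inner 𝕜 (volterra 𝕜 f) g = ∫ x, ∫ y, F x y ∂unitMeasure ∂unitMeasure := by
    rw [L2.inner_def]
    refine integral_congr_ae ?_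
    filter_upwards [coeFn_volterra f, ae_restrict_mem measurableSet_Icc] with x hx hx'
    rw [hx, RCLike.inner_apply', intervalIntegral_eq_setIntegral _ hx', ← integral_conj,
      ← integral_mul_const, ← integral_indicator measurableSet_Iic]
  have e2 : inner 𝕜 f (volterra 𝕜 g) = ∫ y, ∫ x, (Iic y).indicator
      (fun x => starRingEnd 𝕜 (f y) * g x) x ∂unitMeasure ∂unitMeasure := by
    rw [L2.inner_def]
    refine integral_congr_ae ?_
    filter_upwards [coeFn_volterra g, ae_restrict_mem measurableSet_Icc] with x hx hx'
    rw [hx, RCLike.inner_apply', intervalIntegral_eq_setIntegral _ hx',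
      ← integral_const_mul, ← integral_indicator measurableSet_Iic]
  have e3 : inner 𝕜 f (unitFun 𝕜) * inner 𝕜 (unitFun 𝕜) g =
      ∫ y, ∫ x, starRingEnd 𝕜 (f y) * g x ∂unitMeasure ∂unitMeasure := by
    rw [← inner_conj_symm, unitFun, L2.inner_indicatorConstLp_one, L2.inner_indicatorConstLp_one,
      setIntegral_univ, setIntegral_univ, ← integral_conj, ← integral_mul_const]
    simp_rw [integral_const_mul]
  rw [e1, integral_integral_swap hFi, e2, e3, ← integral_add]
  · refine integral_congr_ae ?_
    filter_upwards with y
    rw [← integral_add]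
    · refine integral_congr_ae ?_
      have hne : ∀ᵐ x ∂unitMeasure, x ≠ y := ae_restrict_of_ae (by simp [ae_iff])
      filter_upwards [hne] with x hx
      simp only [hF, indicator, mem_Iic]
      rcases lt_or_gt_of_ne hx with h | h
      · simp [h.le, not_le.2 h]
      · simp [h.le, not_le.2 h]
    · have : (fun x => F x y) = (Ici y).indicator (fun x => starRingEnd 𝕜 (f y) * g x) := by
        ext x; simp [hF, indicator]
      rw [this]
      exact (hg.const_mul _).indicator measurableSet_Ici
    · exact (hg.const_mul _).indicator measurableSet_Iic
  · exact hFi.swap.integral_prod_left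
  · have : (fun y => ∫ x, (Iic y).indicator (fun x => starRingEnd 𝕜 (f y) * g x) x ∂unitMeasure) =ᵐ[
        unitMeasure] fun x => inner 𝕜 (f x) (volterra 𝕜 g x) := by
      filter_upwards [coeFn_volterra g, ae_restrict_mem measurableSet_Icc] with x hx hx'
      rw [hx, RCLike.inner_apply', intervalIntegral_eq_setIntegral _ hx',
        ← integral_const_mul, ← integral_indicator measurableSet_Iic]
    exact (L2.integrable_inner f (volterra 𝕜 g)).congr this.symm

end Volterra

end ParabolicElliptic

/-! ### Energy estimates, decay and uniqueness -/

namespace ParabolicElliptic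

section Energy

open Filter Topology

local notation "⟪" x ", " y "⟫" => inner ℝ x y
local notation "𝟙" => unitFun ℝ
local notation "𝒱" => volterra ℝ

theorem real_inner_volterra_add (f g : L2) : ⟪𝒱 f, g⟫ + ⟪f, 𝒱 g⟫ = ⟪𝟙, f⟫ * ⟪𝟙, g⟫ := by
  rw [inner_volterra_add f g, real_inner_comm]

theorem coeFn_const_add_volterra (a : ℝ) (f : L2) :
    (a • 𝟙 + 𝒱 f : L2) =ᵐ[unitMeasure] fun x => a + ∫ y in (0 : ℝ)..x, f y := by
  filter_upwards [Lp.coeFn_add (a • 𝟙) (𝒱 f), Lp.coeFn_smul a 𝟙, coeFn_unitFun (𝕜 := ℝ),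
    coeFn_volterra f] with x h1 h2 h3 h4
  rw [h1, Pi.add_apply, h2, Pi.smul_apply, h3, h4]
  simp

theorem intervalIntegral_congr_unitMeasure {f g : ℝ → ℝ} (h : f =ᵐ[unitMeasure] g) {x : ℝ}
    (hx : x ∈ Icc (0 : ℝ) 1) : ∫ y in (0 : ℝ)..x, f y = ∫ y in (0 : ℝ)..x, g y := by
  rw [intervalIntegral_eq_setIntegral _ hx, intervalIntegral_eq_setIntegral _ hx]
  exact integral_congr_ae (ae_restrict_of_ae h)

/-- Turns pointwise representatives into identities in L², with `p` the class of `u₁`, so that later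
arguments are Hilbert space algebra. -/
theorem IsH2.exists_volterra {f f₂ : L2} {u u₁ : ℝ → ℝ} (h : IsH2 f f₂ u u₁) :
    ∃ p : L2, p = u₁ 0 • 𝟙 + 𝒱 f₂ ∧ f = u 0 • 𝟙 + 𝒱 p ∧ u₁ 1 = u₁ 0 + ⟪𝟙, f₂⟫ ∧
      u 1 = u 0 + ⟪𝟙, p⟫ := by
  have hp : (u₁ 0 • 𝟙 + 𝒱 f₂ : L2) =ᵐ[unitMeasure] u₁ := by
    filter_upwards [coeFn_const_add_volterra (u₁ 0) f₂, ae_restrict_mem measurableSet_Icc]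
      with x hx hx'
    rw [hx, h.snd x hx']
  refine ⟨_, rfl, ?_, ?_, ?_⟩
  · refine Lp.ext ?_
    filter_upwards [coeFn_const_add_volterra (u 0) (u₁ 0 • 𝟙 + 𝒱 f₂), h.ae_eq,
      ae_restrict_mem measurableSet_Icc] with x hx h1 hx'
    rw [hx, h1, h.fst x hx', intervalIntegral_congr_unitMeasure hp hx']
  · rw [inner_unitFun, h.snd 1 (by simp)]
  · rw [inner_unitFun, intervalIntegral_congr_unitMeasure hp (by simp), h.fst 1 (by simp)]

theorem exists_isH2 (f₂ : L2) (a b : ℝ) :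
    ∃ u u₁ : ℝ → ℝ, IsH2 (b • 𝟙 + 𝒱 (a • 𝟙 + 𝒱 f₂)) f₂ u u₁ ∧ u₁ 0 = a ∧ u 0 = b ∧
      u₁ 1 = a + ⟪𝟙, f₂⟫ ∧ u 1 = b + ⟪𝟙, a • 𝟙 + 𝒱 f₂⟫ := by
  refine ⟨fun x => b + ∫ y in (0 : ℝ)..x, (a • 𝟙 + 𝒱 f₂ : L2) y,
    fun x => a + ∫ y in (0 : ℝ)..x, f₂ y, ⟨coeFn_const_add_volterra _ _, fun x hx => ?_,
      fun x hx => by simp⟩, by simp, by simp, by simp only [inner_unitFun],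
      by simp only [inner_unitFun]⟩
  simp only [intervalIntegral.integral_same, add_zero]
  rw [intervalIntegral_congr_unitMeasure (coeFn_const_add_volterra a f₂) hx]

theorem IsH2.sub {f f₂ g g₂ : L2} {u u₁ v v₁ : ℝ → ℝ} (hf : IsH2 f f₂ u u₁)
    (hg : IsH2 g g₂ v v₁) :
    ∃ w w₁ : ℝ → ℝ, IsH2 (f - g) (f₂ - g₂) w w₁ ∧ w₁ 0 = u₁ 0 - v₁ 0 ∧ w₁ 1 = u₁ 1 - v₁ 1 ∧
      w 1 = u 1 - v 1 := by
  obtain ⟨p, hp, hf', hu₁, hu⟩ := hf.exists_volterra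
  obtain ⟨q, hq, hg', hv₁, hv⟩ := hg.exists_volterra
  obtain ⟨w, w₁, h1, h2, h3, h4, h5⟩ := exists_isH2 (f₂ - g₂) (u₁ 0 - v₁ 0) (u 0 - v 0)
  have hpq : (u₁ 0 - v₁ 0) • 𝟙 + 𝒱 (f₂ - g₂) = p - q := by
    rw [hp, hq, map_sub]; module
  rw [hpq] at h1 h5
  refine ⟨w, w₁, ?_, h2, ?_, ?_⟩
  · convert h1 using 1
    rw [hf', hg', map_sub]; module
  · rw [h4, hu₁, hv₁, inner_sub_right]; ring
  · rw [h5, hu, hv, inner_sub_right]; ring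

/-- Integration by parts, with the term `-‖u₁‖²` discarded. -/
theorem IsH2.inner_le {f f₂ : L2} {u u₁ : ℝ → ℝ} (h : IsH2 f f₂ u u₁) :
    ⟪f₂, f⟫ ≤ u₁ 1 * u 1 - u₁ 0 * u 0 := by
  obtain ⟨p, hp, hf, hu₁, hu⟩ := h.exists_volterra
  have h1 := real_inner_volterra_add f₂ p
  have h2 : ⟪𝒱 f₂, p⟫ = ‖p‖ ^ 2 - u₁ 0 * ⟪𝟙, p⟫ := by
    have h3 : 𝒱 f₂ = p - u₁ 0 • 𝟙 := by rw [hp]; abel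
    rw [h3, inner_sub_left, real_inner_smul_left, real_inner_self_eq_norm_sq]
  have h4 : ⟪f₂, f⟫ = u 0 * ⟪𝟙, f₂⟫ + ⟪f₂, 𝒱 p⟫ := by
    conv_lhs => rw [hf]
    rw [inner_add_right, real_inner_smul_right, real_inner_comm]
  rw [h4]
  rw [h2] at h1
  rw [hu₁, hu]
  nlinarith [sq_nonneg ‖p‖]

variable {ρ α β γ η₂ : ℝ} {w v w' v' : ℝ → L2}

/-- Test the elliptic equation with `v`: the Neumann conditions remove the boundary terms, leaving
`γ ‖v‖² ≤ β ⟪w, v⟫`. -/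
theorem IsSolution.norm_elliptic_le (h : IsSolution ρ α β γ 0 η₂ w v) (hγ : 0 < γ) {t : ℝ}
    (ht : 0 ≤ t) : ‖v t‖ ≤ |β| / γ * ‖w t‖ := by
  obtain ⟨v₂, u, u₁, hH, h0, h1, heq⟩ := h.elliptic t ht
  have h2 := hH.inner_le
  rw [h0, h1, zero_mul, zero_mul, sub_zero] at h2
  have h3 : v₂ = γ • v t - β • w t := by rw [← sub_eq_zero, heq]; abel
  rw [h3, inner_sub_left, real_inner_smul_left, real_inner_smul_left,
    real_inner_self_eq_norm_sq] at h2
  have h4 : β * ⟪w t, v t⟫ ≤ |β| * (‖w t‖ * ‖v t‖) := by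
    refine (le_abs_self _).trans ?_
    rw [abs_mul]
    exact mul_le_mul_of_nonneg_left (abs_real_inner_le_norm _ _) (abs_nonneg _)
  rw [div_mul_eq_mul_div, le_div_iff₀ hγ]
  rcases (norm_nonneg (v t)).eq_or_lt with h5 | h5
  · rw [← h5, zero_mul]; positivity
  · refine le_of_mul_le_mul_right ?_ h5
    nlinarith

/-- Test the parabolic equation with `w`: the Robin boundary term is `-η₂ (u 1)² ≤ 0`, and the
coupling is controlled by the elliptic bound. -/
theorem IsSolution.hasDerivAt_norm_sq (h : IsSolution ρ α β γ 0 η₂ w v) (hγ : 0 < γ)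
    (hη : 0 ≤ η₂) {t : ℝ} (ht : 0 < t) :
    ∃ d, HasDerivAt (fun t => ‖w t‖ ^ 2) d t ∧ d ≤ -2 * (ρ - |α| * |β| / γ) * ‖w t‖ ^ 2 := by
  obtain ⟨w₂, u, u₁, hH, h0, h1, hd⟩ := h.parabolic t ht
  refine ⟨_, hd.norm_sq, ?_⟩
  have h2 := hH.inner_le
  rw [h0, h1] at h2
  have h3 := h.norm_elliptic_le hγ ht.le
  have h4 : α * ⟪w t, v t⟫ ≤ |α| * (‖w t‖ * (|β| / γ * ‖w t‖)) := by
    refine (le_abs_self _).trans ?_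
    rw [abs_mul]
    refine mul_le_mul_of_nonneg_left ((abs_real_inner_le_norm _ _).trans ?_) (abs_nonneg _)
    exact mul_le_mul_of_nonneg_left h3 (norm_nonneg _)
  rw [smul_zero, sub_zero, inner_add_right, inner_sub_right, real_inner_smul_right,
    real_inner_smul_right, real_inner_self_eq_norm_sq, real_inner_comm]
  have h5 : |α| * (‖w t‖ * (|β| / γ * ‖w t‖)) = |α| * |β| / γ * ‖w t‖ ^ 2 := by ring
  rw [h5] at h4
  nlinarith [mul_nonneg hη (sq_nonneg (u 1))]

/-- Gronwall's argument: `exp(2ωt) ‖w t‖²` has nonpositive derivative for `t > 0` and is continuous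
up to `t = 0`. No sign of `ω` is required. -/
theorem IsSolution.norm_le (h : IsSolution ρ α β γ 0 η₂ w v) (hγ : 0 < γ) (hη : 0 ≤ η₂) {t : ℝ}
    (ht : 0 ≤ t) : ‖w t‖ ≤ Real.exp (-(ρ - |α| * |β| / γ) * t) * ‖w 0‖ := by
  set ω := ρ - |α| * |β| / γ with hω
  have hexp : ∀ t : ℝ, HasDerivAt (fun t => Real.exp (2 * ω * t)) (Real.exp (2 * ω * t) * (2 * ω)) t :=
    fun t => by simpa using ((hasDerivAt_id t).const_mul (2 * ω)).exp
  have hD : ∀ t : ℝ, 0 < t → ∃ d, d ≤ 0 ∧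
      HasDerivAt (fun t => Real.exp (2 * ω * t) * ‖w t‖ ^ 2) d t := by
    intro t ht
    obtain ⟨d, hd, hd'⟩ := h.hasDerivAt_norm_sq hγ hη ht
    refine ⟨_, ?_, (hexp t).mul hd⟩
    have := mul_le_mul_of_nonneg_left hd' (Real.exp_pos (2 * ω * t)).le
    rw [← hω] at this
    linarith
  have hanti : AntitoneOn (fun t => Real.exp (2 * ω * t) * ‖w t‖ ^ 2) (Ici 0) := by
    refine antitoneOn_of_deriv_nonpos (convex_Ici 0) ?_ ?_ ?_
    · exact (Continuous.continuousOn (by fun_prop)).mul (h.cont.norm.pow 2)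
    · intro t ht
      rw [interior_Ici] at ht
      obtain ⟨d, _, hd⟩ := hD t ht
      exact hd.differentiableAt.differentiableWithinAt
    · intro t ht
      rw [interior_Ici] at ht
      obtain ⟨d, hd0, hd⟩ := hD t ht
      rwa [hd.deriv]
  have h1 := hanti self_mem_Ici ht ht
  simp only [mul_zero, Real.exp_zero, one_mul] at h1
  refine le_of_sq_le_sq ?_ (by positivity)
  have h2 : Real.exp (-ω * t) ^ 2 * Real.exp (2 * ω * t) = 1 := by
    rw [← Real.exp_nat_mul, ← Real.exp_add]; push_cast; ring_nf; simp
  calc ‖w t‖ ^ 2 = Real.exp (-ω * t) ^ 2 * (Real.exp (2 * ω * t) * ‖w t‖ ^ 2) := by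
        rw [← mul_assoc, h2, one_mul]
    _ ≤ Real.exp (-ω * t) ^ 2 * ‖w 0‖ ^ 2 := by gcongr
    _ = _ := by ring

theorem IsSolution.sub (h : IsSolution ρ α β γ 0 η₂ w v) (h' : IsSolution ρ α β γ 0 η₂ w' v') :
    IsSolution ρ α β γ 0 η₂ (fun t => w t - w' t) (fun t => v t - v' t) where
  cont := h.cont.sub h'.cont
  parabolic t ht := by
    obtain ⟨w₂, u, u₁, hH, h0, h1, hd⟩ := h.parabolic t ht
    obtain ⟨w₂', u', u₁', hH', h0', h1', hd'⟩ := h'.parabolic t ht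
    obtain ⟨z, z₁, hz, hz0, hz1, hz2⟩ := hH.sub hH'
    refine ⟨_, z, z₁, hz, by rw [hz0, h0, h0', sub_zero], by rw [hz1, hz2, h1, h1']; ring, ?_⟩
    refine (hd.sub hd').congr_deriv ?_
    simp only [smul_zero, sub_zero, smul_sub]
    abel
  elliptic t ht := by
    obtain ⟨w₂, u, u₁, hH, h0, h1, hd⟩ := h.elliptic t ht
    obtain ⟨w₂', u', u₁', hH', h0', h1', hd'⟩ := h'.elliptic t ht
    obtain ⟨z, z₁, hz, hz0, hz1, hz2⟩ := hH.sub hH'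
    refine ⟨_, z, z₁, hz, by rw [hz0, h0, h0', sub_zero], by rw [hz1, h1, h1', sub_zero], ?_⟩
    have : (0 : L2) = 0 - 0 := by simp
    rw [this]
    nth_rw 1 [hd]
    rw [hd']
    module

theorem IsSolution.unique (h : IsSolution ρ α β γ 0 η₂ w v) (h' : IsSolution ρ α β γ 0 η₂ w' v')
    (hγ : 0 < γ) (hη : 0 ≤ η₂) (h0 : w 0 = w' 0) {t : ℝ} (ht : 0 ≤ t) :
    w t = w' t ∧ v t = v' t := by
  have hs := h.sub h'
  have h1 := hs.norm_le hγ hη ht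
  have h2 := hs.norm_elliptic_le hγ ht
  simp only [h0, sub_self, norm_zero, mul_zero] at h1
  have h3 := le_antisymm h1 (norm_nonneg _)
  rw [h3, mul_zero] at h2
  exact ⟨sub_eq_zero.1 (norm_eq_zero.1 h3),
    sub_eq_zero.1 (norm_eq_zero.1 (le_antisymm h2 (norm_nonneg _)))⟩

end Energy

end ParabolicElliptic

/-! ### Semigroups from the functional calculus of the inverse generator -/

namespace ParabolicElliptic

open Filter Topology ComplexOrder

section Semigroup

/-- The function `τ ↦ exp(-t/τ)`, extended by zero to `τ ≤ 0`. -/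
noncomputable def expNegDiv (t τ : ℝ) : ℝ := if 0 < τ then Real.exp (-t / τ) else 0

/-- The function `τ ↦ exp(-t/τ)/τ`, extended by zero to `τ ≤ 0`. -/
noncomputable def expNegDivDiv (t τ : ℝ) : ℝ := if 0 < τ then Real.exp (-t / τ) / τ else 0

theorem expNegDivDiv_tendsto {t : ℝ} (ht : 0 < t) :
    Tendsto (fun τ : ℝ => Real.exp (-t / τ) / τ) (𝓝[>] 0) (𝓝 0) := by
  have h := (Real.tendsto_pow_mul_exp_neg_atTop_nhds_zero 1).comp
    ((tendsto_inv_nhdsGT_zero (𝕜 := ℝ)).const_mul_atTop ht)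
  have h2 := h.const_mul t⁻¹
  rw [mul_zero] at h2
  refine h2.congr fun τ => ?_
  simp only [Function.comp_apply, pow_one, div_eq_mul_inv]
  field_simp

theorem continuous_expNegDivDiv {t : ℝ} (ht : 0 < t) : Continuous (expNegDivDiv t) := by
  have h : expNegDivDiv t = fun τ => if τ ≤ 0 then 0 else Real.exp (-t / τ) / τ := by
    ext τ
    by_cases hτ : 0 < τ
    · simp [expNegDivDiv, hτ, not_le.2 hτ]
    · simp [expNegDivDiv, hτ, not_lt.1 hτ]
  rw [continuous_iff_continuousAt]
  intro τ
  rcases lt_trichotomy τ 0 with hτ | rfl | hτ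
  · refine ContinuousAt.congr (f := fun _ => (0 : ℝ)) continuousAt_const ?_
    filter_upwards [Iio_mem_nhds hτ] with s hs
    simp [expNegDivDiv, not_lt.2 (mem_Iio.1 hs).le]
  · rw [continuousAt_iff_continuous_left'_right']
    have h0 : expNegDivDiv t 0 = 0 := by simp [expNegDivDiv]
    constructor
    · refine ContinuousWithinAt.congr (f := fun _ => (0 : ℝ)) continuousWithinAt_const ?_ h0
      intro s hs
      simp [expNegDivDiv, not_lt.2 (mem_Iio.1 hs).le]
    · rw [ContinuousWithinAt, h0]
      refine (expNegDivDiv_tendsto ht).congr' ?_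
      filter_upwards [self_mem_nhdsWithin] with s hs
      simp [expNegDivDiv, show 0 < s from hs]
  · refine ContinuousAt.congr (f := fun τ => Real.exp (-t / τ) / τ) ?_ ?_
    · have := hτ.ne'
      fun_prop (disch := assumption)
    · filter_upwards [Ioi_mem_nhds hτ] with s hs
      simp [expNegDivDiv, show 0 < s from hs]

theorem expNegDiv_eq (t τ : ℝ) : expNegDiv t τ = τ * expNegDivDiv t τ := by
  unfold expNegDiv expNegDivDiv
  split_ifs with h
  · field_simp
  · simp

theorem continuous_expNegDiv {t : ℝ} (ht : 0 < t) : Continuous (expNegDiv t) := by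
  have := continuous_expNegDivDiv ht
  rw [show expNegDiv t = fun τ => τ * expNegDivDiv t τ from funext (expNegDiv_eq t)]
  fun_prop

theorem expNegDiv_nonneg (t τ : ℝ) : 0 ≤ expNegDiv t τ := by
  unfold expNegDiv; split_ifs <;> positivity

theorem expNegDiv_le_one {t : ℝ} (ht : 0 ≤ t) (τ : ℝ) : expNegDiv t τ ≤ 1 := by
  unfold expNegDiv
  split_ifs with h
  · rw [Real.exp_le_one_iff, neg_div]
    have := div_nonneg ht h.le
    linarith
  · exact zero_le_one

theorem abs_expNegDiv_sub_one_mul_le {t : ℝ} (ht : 0 ≤ t) {τ : ℝ} (hτ : 0 ≤ τ) :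
    |expNegDiv t τ * τ - τ| ≤ t := by
  rcases hτ.eq_or_lt with rfl | hτ
  · simpa using ht
  have h1 := expNegDiv_le_one ht τ
  rw [abs_of_nonpos (by nlinarith)]
  simp only [expNegDiv, hτ, if_true]
  have h2 := Real.add_one_le_exp (-t / τ)
  have h3 : (-t / τ) * τ = -t := by field_simp
  nlinarith

/-- A second order Taylor estimate for `t ↦ exp(-t s)`, uniform in `s ≥ 0`. -/
theorem abs_exp_taylor_le {t h s : ℝ} (ht : 0 < t) (hh : |h| ≤ t / 2) (hs : 0 ≤ s) :
    |Real.exp (-(t + h) * s) - Real.exp (-t * s) + h * (s * Real.exp (-t * s))| ≤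
      16 / t ^ 2 * h ^ 2 := by
  have key : ∀ x : ℝ, |Real.exp x - 1 - x| ≤ x ^ 2 * Real.exp |x| := by
    intro x
    have h1 := Real.add_one_le_exp x
    rw [abs_of_nonneg (by linarith)]
    have h3 : 0 ≤ Real.exp x := (Real.exp_pos x).le
    have h2 := Real.add_one_le_exp (-x)
    have h4 : Real.exp x * Real.exp (-x) = 1 := by rw [← Real.exp_add]; simp
    have h5 : Real.exp x * (1 - x) ≤ 1 := by nlinarith
    rcases le_total 0 x with hx | hx
    · rw [abs_of_nonneg hx]
      nlinarith
    · have h6 : 1 ≤ Real.exp |x| := Real.one_le_exp (abs_nonneg x)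
      nlinarith [sq_nonneg x]
  have hsplit : Real.exp (-(t + h) * s) - Real.exp (-t * s) + h * (s * Real.exp (-t * s)) =
      Real.exp (-t * s) * (Real.exp (-h * s) - 1 - (-h * s)) := by
    rw [show -(t + h) * s = -t * s + -h * s by ring, Real.exp_add]; ring
  rw [hsplit, abs_mul, abs_of_pos (Real.exp_pos _)]
  have h1 := key (-h * s)
  have h2 : |(-h * s)| ≤ t / 2 * s := by
    rw [abs_mul, abs_neg, abs_of_nonneg hs]
    exact mul_le_mul_of_nonneg_right hh hs
  have h3 : Real.exp |(-h * s)| ≤ Real.exp (t / 2 * s) := Real.exp_le_exp.2 h2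
  -- Half of the decay of `exp(-t s)` pays for the growth in the remainder, the other half for the
  -- factor `s ^ 2`.
  have h4 : (t * s / 4) ^ 2 ≤ Real.exp (t / 2 * s) := by
    have h5 : t * s / 4 ≤ Real.exp (t * s / 4) := by linarith [Real.add_one_le_exp (t * s / 4)]
    have h6 : Real.exp (t / 2 * s) = Real.exp (t * s / 4) ^ 2 := by
      rw [← Real.exp_nat_mul]; congr 1; push_cast; ring
    rw [h6]
    exact pow_le_pow_left₀ (by positivity) h5 2
  have h7 : Real.exp (-t * s) * Real.exp (t / 2 * s) * Real.exp (t / 2 * s) = 1 := by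
    rw [← Real.exp_add, ← Real.exp_add]; ring_nf; simp
  have hA : 0 < Real.exp (-t * s) := Real.exp_pos _
  calc Real.exp (-t * s) * |Real.exp (-h * s) - 1 - -h * s|
      ≤ Real.exp (-t * s) * ((-h * s) ^ 2 * Real.exp (t / 2 * s)) := by
        refine mul_le_mul_of_nonneg_left (h1.trans ?_) hA.le
        exact mul_le_mul_of_nonneg_left h3 (sq_nonneg _)
    _ = 16 / t ^ 2 * h ^ 2 *
          (Real.exp (-t * s) * Real.exp (t / 2 * s) * (t * s / 4) ^ 2) := by
        field_simp; ring
    _ ≤ 16 / t ^ 2 * h ^ 2 *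
          (Real.exp (-t * s) * Real.exp (t / 2 * s) * Real.exp (t / 2 * s)) := by
        gcongr
    _ = 16 / t ^ 2 * h ^ 2 := by rw [h7, mul_one]

theorem abs_expNegDiv_taylor_le {t h : ℝ} (ht : 0 < t) (hh : |h| ≤ t / 2) (τ : ℝ) :
    |expNegDiv (t + h) τ - expNegDiv t τ + h * expNegDivDiv t τ| ≤ 16 / t ^ 2 * h ^ 2 := by
  by_cases hτ : 0 < τ
  · have := abs_exp_taylor_le ht hh (inv_nonneg.2 hτ.le)
    simp only [expNegDiv, expNegDivDiv, hτ, if_true]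
    simp only [div_eq_mul_inv]
    rwa [mul_comm (Real.exp (-t * τ⁻¹))]
  · simp only [expNegDiv, expNegDivDiv, hτ, if_false]
    simp; positivity

variable {H : Type*} [NormedAddCommGroup H] [InnerProductSpace ℂ H] [CompleteSpace H]

/-- Formally this is `d/dt exp(-tA) = -A exp(-tA)` with `A = T⁻¹`. The scalar Taylor remainder is
`O(h²)` uniformly on the spectrum, so the derivative exists in operator norm. -/
theorem hasDerivAt_cfc_expNegDiv {T : H →L[ℂ] H} (_hT : 0 ≤ T) {t : ℝ} (ht : 0 < t) :
    HasDerivAt (fun t => cfc (expNegDiv t) T) (-cfc (expNegDivDiv t) T) t := by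
  rw [hasDerivAt_iff_isLittleO_nhds_zero]
  refine Asymptotics.IsBigO.trans_isLittleO (g := fun h : ℝ => h ^ 2) ?_ ?_
  · refine Asymptotics.IsBigO.of_bound (16 / t ^ 2) ?_
    have h1 : ∀ᶠ h : ℝ in 𝓝 0, |h| ≤ t / 2 := by
      filter_upwards [Metric.closedBall_mem_nhds (0 : ℝ) (half_pos ht)] with h hh
      simpa using hh
    filter_upwards [h1] with h hh
    have hth : 0 < t + h := by linarith [neg_abs_le h]
    have c1 := (continuous_expNegDiv hth).continuousOn (s := spectrum ℝ T)
    have c2 := (continuous_expNegDiv ht).continuousOn (s := spectrum ℝ T)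
    have c3 := (continuous_expNegDivDiv ht).continuousOn (s := spectrum ℝ T)
    have e : cfc (expNegDiv (t + h)) T - cfc (expNegDiv t) T - h • -cfc (expNegDivDiv t) T =
        cfc (fun τ => expNegDiv (t + h) τ - expNegDiv t τ + h * expNegDivDiv t τ) T := by
      rw [cfc_add (a := T) (fun τ => expNegDiv (t + h) τ - expNegDiv t τ)
        (fun τ => h * expNegDivDiv t τ) (by fun_prop) (by fun_prop),
        cfc_sub (expNegDiv (t + h)) (expNegDiv t) T, cfc_const_mul h (expNegDivDiv t) T]
      simp
    rw [e]
    refine norm_cfc_le (by positivity) fun τ _ => ?_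
    rw [Real.norm_eq_abs, Real.norm_of_nonneg (sq_nonneg h)]
    exact abs_expNegDiv_taylor_le ht hh τ
  · simpa using Asymptotics.isLittleO_pow_id (𝕜 := ℝ) (n := 2) (by norm_num)

theorem norm_cfc_expNegDiv_le (T : H →L[ℂ] H) {t : ℝ} (ht : 0 < t) :
    ‖cfc (expNegDiv t) T‖ ≤ 1 := by
  refine norm_cfc_le zero_le_one fun τ _ => ?_
  rw [Real.norm_of_nonneg (expNegDiv_nonneg t τ)]
  exact expNegDiv_le_one ht.le τ

theorem norm_cfc_expNegDiv_mul_sub_le {T : H →L[ℂ] H} (hT : 0 ≤ T) {t : ℝ} (ht : 0 < t) :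
    ‖cfc (expNegDiv t) T * T - T‖ ≤ t := by
  have c2 := (continuous_expNegDiv ht).continuousOn (s := spectrum ℝ T)
  have e : cfc (expNegDiv t) T * T - T = cfc (fun τ => expNegDiv t τ * τ - τ) T := by
    rw [cfc_sub (fun τ => expNegDiv t τ * τ) (fun τ => τ) T, cfc_mul (expNegDiv t) (fun τ => τ) T,
      cfc_id' ℝ T]
  rw [e]
  refine norm_cfc_le ht.le fun τ hτ => ?_
  exact abs_expNegDiv_sub_one_mul_le ht.le (spectrum_nonneg_of_nonneg hT hτ)

/-- An injective self-adjoint operator has dense range. On that range convergence has rate `t ‖y‖`,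
and uniform contractivity extends it to every vector. -/
theorem tendsto_cfc_expNegDiv {T : H →L[ℂ] H} (hT : 0 ≤ T) (hinj : Function.Injective T) (x : H) :
    Tendsto (fun t => cfc (expNegDiv t) T x) (𝓝[>] 0) (𝓝 x) := by
  have hdense : DenseRange T := by
    have h1 : T.rangeᗮ = ⊥ := by
      rw [ContinuousLinearMap.orthogonal_range, (IsSelfAdjoint.of_nonneg hT).adjoint_eq]
      exact LinearMap.ker_eq_bot.2 hinj
    have := (Submodule.dense_iff_topologicalClosure_eq_top).2
      ((Submodule.topologicalClosure_eq_top_iff).2 h1)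
    exact this
  rw [Metric.tendsto_nhds]
  intro ε hε
  obtain ⟨y, hy⟩ := hdense.exists_dist_lt x (show 0 < ε / 4 by positivity)
  have hlt : ∀ᶠ t : ℝ in 𝓝[>] 0, t * ‖y‖ < ε / 4 := by
    have h0 : Tendsto (fun t : ℝ => t * ‖y‖) (𝓝[>] 0) (𝓝 0) := by
      have : Tendsto (fun t : ℝ => t * ‖y‖) (𝓝 0) (𝓝 (0 * ‖y‖)) :=
        (continuous_id.mul continuous_const).tendsto 0
      rw [zero_mul] at this
      exact this.mono_left nhdsWithin_le_nhds
    exact h0.eventually_lt_const (by positivity)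
  filter_upwards [hlt, self_mem_nhdsWithin] with t ht1 ht
  set S := cfc (expNegDiv t) T with hS
  have h1 : ‖S (x - T y)‖ ≤ ‖x - T y‖ :=
    (S.le_of_opNorm_le (norm_cfc_expNegDiv_le T ht) _).trans_eq (one_mul _)
  have h2 : ‖(S * T - T) y‖ ≤ t * ‖y‖ :=
    ((S * T - T).le_opNorm _).trans
      (mul_le_mul_of_nonneg_right (norm_cfc_expNegDiv_mul_sub_le hT ht) (norm_nonneg _))
  rw [dist_eq_norm] at hy ⊢
  have e : S x - x = S (x - T y) + (S * T - T) y + (T y - x) := by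
    simp
  rw [e]
  have h3 : ‖T y - x‖ < ε / 4 := by rwa [norm_sub_rev]
  calc _ ≤ ‖S (x - T y)‖ + ‖(S * T - T) y‖ + ‖T y - x‖ := norm_add₃_le
    _ < ε := by linarith

/-- If `T` is nonnegative and injective, then `-T⁻¹` generates a semigroup which maps into the
domain of `T⁻¹` at all positive times. -/
theorem exists_semigroup_orbit {T : H →L[ℂ] H} (hT : 0 ≤ T) (hinj : Function.Injective T) (x : H) :
    ∃ w : ℝ → H, ContinuousOn w (Ici 0) ∧ w 0 = x ∧
      ∀ t, 0 < t → ∃ g, w t = T g ∧ HasDerivAt w (-g) t := by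
  -- The value at `t = 0` is set by hand: `expNegDiv 0` jumps at `τ = 0`, so the functional calculus
  -- need not apply there.
  set w : ℝ → H := fun t => if 0 < t then cfc (expNegDiv t) T x else x with hw
  have hderiv : ∀ t, 0 < t → HasDerivAt w (-(cfc (expNegDivDiv t) T x)) t := by
    intro t ht
    have h := ((ContinuousLinearMap.apply ℂ H x).restrictScalars ℝ).hasFDerivAt.comp_hasDerivAt t
      (hasDerivAt_cfc_expNegDiv hT ht)
    refine HasDerivAt.congr_of_eventuallyEq h ?_
    filter_upwards [Ioi_mem_nhds ht] with s hs
    simp [hw, show 0 < s from hs]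
  have h0 : w 0 = x := by simp [hw]
  refine ⟨w, ?_, h0, fun t ht => ⟨cfc (expNegDivDiv t) T x, ?_, hderiv t ht⟩⟩
  · intro t ht
    rcases (show (0 : ℝ) ≤ t from ht).eq_or_lt with rfl | ht
    · rw [← Ioi_insert, continuousWithinAt_insert_self, ContinuousWithinAt, h0]
      refine (tendsto_cfc_expNegDiv hT hinj x).congr' ?_
      filter_upwards [self_mem_nhdsWithin] with s hs
      simp [hw, show 0 < s from hs]
    · exact (hderiv t ht).continuousAt.continuousWithinAt
  · simp only [hw, ht, if_true]
    have c3 := (continuous_expNegDivDiv ht).continuousOn (s := spectrum ℝ T)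
    have e : cfc (expNegDiv t) T = T * cfc (expNegDivDiv t) T := by
      rw [show expNegDiv t = fun τ => τ * expNegDivDiv t τ from funext (expNegDiv_eq t),
        cfc_mul (fun τ => τ) (expNegDivDiv t) T, cfc_id' ℝ T]
    rw [e, mul_apply_eq_comp]

end Semigroup

end ParabolicElliptic

/-! ### Abstract Robin inverse and Neumann resolvent -/

namespace ParabolicElliptic

open ComplexOrder

section Operators

variable {H : Type*} [NormedAddCommGroup H] [InnerProductSpace ℂ H]

local notation "⟪" x ", " y "⟫" => inner ℂ x y

/-- The rank one operator `f ↦ ⟪e, f⟫ e`. -/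
noncomputable def rankOneProj (e : H) : H →L[ℂ] H := (innerSL ℂ e).smulRight e

theorem rankOneProj_apply (e f : H) : rankOneProj e f = ⟪e, f⟫ • e := rfl

theorem rankOneProj_mul_self {e : H} (he : ‖e‖ = 1) :
    rankOneProj e * rankOneProj e = rankOneProj e := by
  ext f
  simp [rankOneProj_apply, inner_self_eq_norm_sq_to_K, he]

variable [CompleteSpace H]

theorem adjoint_rankOneProj (e : H) : star (rankOneProj e) = rankOneProj e := by
  rw [ContinuousLinearMap.star_eq_adjoint, eq_comm, ContinuousLinearMap.eq_adjoint_iff]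
  intro x y
  simp only [rankOneProj_apply, inner_smul_left, inner_smul_right, inner_conj_symm]
  ring

theorem rankOneProj_nonneg {e : H} (he : ‖e‖ = 1) : 0 ≤ rankOneProj e := by
  have := star_mul_self_nonneg (rankOneProj e)
  rwa [adjoint_rankOneProj, rankOneProj_mul_self he] at this

/-- The inverse of the sum of the inverse of a nonnegative injective operator `T₀` and a nonnegative
bounded operator `N`. -/
theorem exists_inverse_add {T₀ N : H →L[ℂ] H} (hT₀ : 0 ≤ T₀) (hinj : Function.Injective T₀)
    (hN : 0 ≤ N) :
    ∃ T : H →L[ℂ] H, 0 ≤ T ∧ Function.Injective T ∧ ∀ f, T f = T₀ (f - N (T f)) := by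
  -- With `T₀ = A⁻¹`, the symmetric factorisation `(A + N)⁻¹ = W (1 + W N W)⁻¹ W` keeps the inverse
  -- nonnegative and avoids unbounded operators.
  set W := CFC.sqrt T₀ with hW
  have hW0 : 0 ≤ W := CFC.sqrt_nonneg T₀
  have hWW : W * W = T₀ := CFC.sqrt_mul_sqrt_self T₀
  have hWNW : 0 ≤ W * N * W := conjugate_nonneg_of_nonneg hN hW0
  have h1 : (1 : H →L[ℂ] H) ≤ 1 + W * N * W := le_add_of_nonneg_right hWNW
  have hu : IsUnit (1 + W * N * W) :=
    CStarAlgebra.isUnit_of_le 1 h1 isStrictlyPositive_one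
  obtain ⟨U, hU⟩ := hu
  have hU0 : 0 ≤ (U : H →L[ℂ] H) := by rw [hU]; exact zero_le_one.trans h1
  have hUi : 0 ≤ ((U⁻¹ : (H →L[ℂ] H)ˣ) : H →L[ℂ] H) := CFC.inv_nonneg_of_nonneg U hU0
  set Z := ((U⁻¹ : (H →L[ℂ] H)ˣ) : H →L[ℂ] H) with hZ
  have hT : W * Z * W = T₀ * (1 - N * (W * Z * W)) := by
    have h2 : (1 + W * N * W) * Z = 1 := by rw [← hU]; exact U.mul_inv
    have h3 : Z = 1 - W * N * W * Z := by rw [← h2]; noncomm_ring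
    calc W * Z * W = W * (1 - W * N * W * Z) * W := by rw [← h3]
      _ = W * W * (1 - N * (W * Z * W)) := by noncomm_ring
      _ = _ := by rw [hWW]
  have happ : ∀ f, (W * Z * W) f = T₀ (f - N ((W * Z * W) f)) := fun f => by
    conv_lhs => rw [hT]
    simp
  refine ⟨W * Z * W, conjugate_nonneg_of_nonneg hUi hW0, ?_, happ⟩
  rw [injective_iff_map_eq_zero]
  intro f hf
  have := happ f
  rw [hf, map_zero, sub_zero] at this
  exact hinj (by rw [← this, map_zero])

variable {V : H →L[ℂ] H} {e : H}

/-- The inverse of `-∂ₓₓ` with a homogeneous Neumann condition at `0` and the Robin condition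
`u'(1) = -κ u(1)` at `1`, in terms of an abstract Volterra operator `V`. -/
theorem exists_robin_inverse (he : ‖e‖ = 1) (hV : V + star V = rankOneProj e)
    (hinj : Function.Injective V) {κ : ℝ} (hκ : 0 < κ) :
    ∃ T₀ : H →L[ℂ] H, 0 ≤ T₀ ∧ Function.Injective T₀ ∧
      ∀ f, T₀ f = ((κ⁻¹ : ℂ) * ⟪e, f⟫ + ⟪e, V f⟫) • e - V (V f) := by
  have hJ := rankOneProj_nonneg he
  have hs : star V = rankOneProj e - V := by rw [← hV]; abel
  have hJ' : 0 ≤ (κ⁻¹ : ℝ) • rankOneProj e := smul_nonneg (inv_nonneg.2 hκ.le) hJ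
  -- This form makes nonnegativity evident; substituting `V* = J - V` gives the required formula.
  refine ⟨(κ⁻¹ : ℝ) • rankOneProj e + star V * V, add_nonneg hJ' (star_mul_self_nonneg V), ?_, ?_⟩
  · rw [injective_iff_map_eq_zero]
    intro f hf
    have h1 := ((ContinuousLinearMap.nonneg_iff_isPositive _).1 hJ').re_inner_nonneg_right f
    have h2 : ⟪f, (star V * V) f⟫ = ⟪V f, V f⟫ := by
      rw [ContinuousLinearMap.star_eq_adjoint, mul_apply_eq_comp,
        ContinuousLinearMap.adjoint_inner_right]
    have h3 : ⟪f, ((κ⁻¹ : ℝ) • rankOneProj e + star V * V) f⟫ = 0 := by rw [hf, inner_zero_right]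
    rw [add_apply, inner_add_right, h2] at h3
    have h4 := congrArg Complex.re h3
    have h5 : (⟪V f, V f⟫).re = ‖V f‖ ^ 2 := by
      rw [inner_self_eq_norm_sq_to_K]; norm_cast
    rw [Complex.add_re, h5, Complex.zero_re] at h4
    have h6 : ‖V f‖ = 0 := by
      have h1' : 0 ≤ (⟪f, ((κ⁻¹ : ℝ) • rankOneProj e) f⟫).re := h1
      nlinarith [norm_nonneg (V f)]
    exact hinj (by rw [norm_eq_zero.1 h6, map_zero])
  · intro f
    rw [hs]
    simp only [add_apply, mul_apply_eq_comp, sub_apply,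
      smul_apply, rankOneProj_apply, add_smul, mul_smul]
    rw [← Complex.ofReal_inv, Complex.coe_smul]
    abel

/-- The resolvent `(γ - ∂ₓₓ)⁻¹` with homogeneous Neumann conditions, in terms of an abstract
Volterra operator `V`. -/
theorem exists_neumann_resolvent (he : ‖e‖ = 1) (hV : V + star V = rankOneProj e) {γ : ℝ}
    (hγ : 0 < γ) :
    ∃ R : H →L[ℂ] H, IsSelfAdjoint R ∧
      ∀ g, ∃ (q : H) (b : ℂ), ⟪e, q⟫ = 0 ∧ R g = b • e + V (V q) ∧ γ • R g = q + g := by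
  set J := rankOneProj e with hJ
  have hs : star V = J - V := by rw [← hV]; abel
  set P := 1 - J with hP
  have hJJ : J * J = J := rankOneProj_mul_self he
  have hPP : P * P = P := by rw [hP]; noncomm_ring; rw [hJJ]; abel
  have hPs : star P = P := by rw [hP, star_sub, star_one, adjoint_rankOneProj]
  have hJP : J * P = 0 := by rw [hP, mul_sub, mul_one, hJJ, sub_self]
  have hD : 0 ≤ P * (star V * V) * P := by
    have := star_mul_self_nonneg (V * P)
    rw [star_mul, hPs] at this
    simpa only [mul_assoc] using this
  have h1 : (1 : H →L[ℂ] H) ≤ 1 + γ • (P * (star V * V) * P) :=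
    le_add_of_nonneg_right (smul_nonneg hγ.le hD)
  obtain ⟨U, hU⟩ := CStarAlgebra.isUnit_of_le 1 h1 isStrictlyPositive_one
  have hU0 : 0 ≤ (U : H →L[ℂ] H) := by rw [hU]; exact zero_le_one.trans h1
  have hUi : 0 ≤ ((U⁻¹ : (H →L[ℂ] H)ˣ) : H →L[ℂ] H) := CFC.inv_nonneg_of_nonneg U hU0
  set Z := ((U⁻¹ : (H →L[ℂ] H)ˣ) : H →L[ℂ] H) with hZ
  have hUZ : (1 + γ • (P * (star V * V) * P)) * Z = 1 := by rw [← hU]; exact U.mul_inv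
  -- On the mean-zero subspace `P V* V P` inverts the Neumann Laplacian. Thus `Q` represents `-∂ₓₓ
  -- (γ - ∂ₓₓ)⁻¹`, and the resolvent is `γ⁻¹ (1 - Q)`.
  set Q := P * Z * P with hQ
  have hQsa : IsSelfAdjoint Q := by
    have := (IsSelfAdjoint.of_nonneg hUi).conjugate P
    rwa [hPs] at this
  have hPZ : Q + γ • (P * (star V * V) * Q) = P := by
    have h2 : P * ((1 + γ • (P * (star V * V) * P)) * Z) * P = P := by rw [hUZ, mul_one, hPP]
    refine Eq.trans ?_ h2
    rw [hQ]
    simp only [add_mul, mul_add, one_mul, smul_mul_assoc, mul_smul_comm]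
    congr 2
    simp only [← mul_assoc, hPP]
  have hJQ : J * Q = 0 := by rw [hQ, ← mul_assoc, ← mul_assoc, hJP, zero_mul, zero_mul]
  refine ⟨(γ⁻¹ : ℝ) • (1 - Q), ?_, fun g => ?_⟩
  · exact (IsSelfAdjoint.all (γ⁻¹ : ℝ)).smul ((IsSelfAdjoint.one _).sub hQsa)
  have hJg : ⟪e, Q g⟫ = 0 := by
    have h3 : ⟪e, Q g⟫ • e = 0 := by
      exact congrArg (fun A : H →L[ℂ] H => A g) hJQ
    rcases smul_eq_zero.1 h3 with h | h
    · exact h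
    · simp [h] at he
  -- Apply `hPZ` to `g` and expand both `P` and `V*`: all terms other than the double primitive of
  -- `-Q g` are multiples of `e`.
  have hmain : g - Q g = (⟪e, g⟫ + γ * (⟪e, V (Q g)⟫ - ⟪e, (star V * V) (Q g)⟫)) • e +
      γ • V (V (-Q g)) := by
    have h4 := congrArg (fun A : H →L[ℂ] H => A g) hPZ
    have h5 : ∀ x, P x = x - ⟪e, x⟫ • e := fun x => rfl
    simp only [add_apply, smul_apply, mul_apply_eq_comp,
      h5] at h4
    have h6 : (star V) (V (Q g)) = ⟪e, V (Q g)⟫ • e - V (V (Q g)) := by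
      rw [hs]; rfl
    have h7 : g - Q g = ⟪e, g⟫ • e +
        γ • ((star V) (V (Q g)) - ⟪e, (star V) (V (Q g))⟫ • e) := by
      rw [eq_comm, ← sub_eq_iff_eq_add'] at *
      rw [← sub_eq_zero] at h4 ⊢
      rw [← neg_eq_zero, ← h4]
      abel
    rw [h7]
    simp only [mul_apply_eq_comp]
    nth_rw 1 [h6]
    rw [map_neg, map_neg, ← Complex.coe_smul, ← Complex.coe_smul]
    module
  refine ⟨-Q g, (γ⁻¹ : ℝ) • (⟪e, g⟫ + γ * (⟪e, V (Q g)⟫ - ⟪e, (star V * V) (Q g)⟫)), ?_, ?_, ?_⟩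
  · rw [inner_neg_right, hJg, neg_zero]
  · simp only [smul_apply, sub_apply,
      one_apply_eq_self]
    rw [hmain, smul_add, smul_smul, inv_mul_cancel₀ hγ.ne', one_smul, smul_assoc]
  · simp only [smul_apply, sub_apply,
      one_apply_eq_self]
    rw [smul_smul, mul_inv_cancel₀ hγ.ne', one_smul]
    abel

end Operators

end ParabolicElliptic

/-! ### Existence of solutions and conclusion -/

namespace ParabolicElliptic

section Orbit

open ComplexOrder

/-- The orbits of the parabolic-elliptic system, in terms of an abstract Volterra operator `V`,
and their images under a real-linear map. -/
theorem exists_orbit {H E : Type*} [NormedAddCommGroup H] [InnerProductSpace ℂ H] [CompleteSpace H]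
    [NormedAddCommGroup E] [NormedSpace ℝ E] {V : H →L[ℂ] H} {e : H} (he : ‖e‖ = 1)
    (hV : V + star V = rankOneProj e) (hinj : Function.Injective V) {γ κ : ℝ} (hγ : 0 < γ)
    (hκ : 0 < κ) (ρ δ : ℝ) (r : H →+ E) (hrc : Continuous r)
    (hr : ∀ (a : ℝ) (x : H), r ((a : ℂ) • x) = a • r x) (w₀ : H) :
    ∃ (R : H →L[ℂ] H) (w : ℝ → H),
      (∀ g, ∃ (q : H) (b : ℂ), inner ℂ e q = 0 ∧ R g = b • e + V (V q) ∧
        (γ : ℂ) • R g = q + g) ∧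
      ContinuousOn w (Ici 0) ∧ w 0 = w₀ ∧
      ∀ t, 0 < t → ∃ h,
        w t = ((κ⁻¹ : ℂ) * inner ℂ e h + inner ℂ e (V h)) • e - V (V h) ∧
        HasDerivAt (fun t => r (w t)) (-r h - ρ • r (w t) + δ • r (R (w t))) t := by
  obtain ⟨R, hR, hRe⟩ := exists_neumann_resolvent he hV hγ
  obtain ⟨T₀, hT₀, hT₀i, hT₀e⟩ := exists_robin_inverse he hV hinj hκ
  set N : H →L[ℂ] H := ρ • 1 - δ • R with hN
  have hNs : IsSelfAdjoint N :=
    ((IsSelfAdjoint.all ρ).smul (IsSelfAdjoint.one _)).sub ((IsSelfAdjoint.all δ).smul hR)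
  -- Shifting by `‖N‖` makes the perturbation nonnegative; the factor `exp(σ t)` in the orbit undoes
  -- the shift.
  set σ := ‖N‖ with hσ
  have hN' : 0 ≤ N + σ • 1 := by
    have := hNs.neg_algebraMap_norm_le_self
    rw [Algebra.algebraMap_eq_smul_one] at this
    exact neg_le_iff_add_nonneg.1 this
  obtain ⟨T, hT, hTi, hTe⟩ := exists_inverse_add hT₀ hT₀i hN'
  obtain ⟨z, hzc, hz0, hz⟩ := exists_semigroup_orbit hT hTi w₀
  have hexp : Continuous fun t => Real.exp (σ * t) := by fun_prop
  refine ⟨R, fun t => Real.exp (σ * t) • z t, fun g => ?_, hexp.continuousOn.smul hzc, ?_,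
    fun t ht => ?_⟩
  · obtain ⟨q, b, h1, h2, h3⟩ := hRe g
    exact ⟨q, b, h1, h2, by rw [Complex.coe_smul, h3]⟩
  · simp [hz0]
  obtain ⟨g, hg, hd⟩ := hz t ht
  -- Here `g = (A + N + σ) z` with `A = T₀⁻¹`, so `h = A w`, which plays the role of `-w_xx`.
  set h := Real.exp (σ * t) • (g - (N + σ • 1) (z t)) with hh
  have hsmul : ∀ (A : H →L[ℂ] H) (a : ℝ) (x : H), A (a • x) = a • A x := fun A a x => by
    rw [← Complex.coe_smul, map_smul, Complex.coe_smul]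
  have hwt : Real.exp (σ * t) • z t = T₀ h := by
    rw [hh, hg, hsmul, ← hTe g]
  refine ⟨h, by rw [← hT₀e, ← hwt], ?_⟩
  have h1 : HasDerivAt (fun t => Real.exp (σ * t)) (Real.exp (σ * t) * σ) t := by
    simpa using ((hasDerivAt_id t).const_mul σ).exp
  let r' : H →L[ℝ] E :=
    { toFun := r
      map_add' := r.map_add
      map_smul' := fun a x => by rw [← Complex.coe_smul, hr]; rfl
      cont := hrc }
  have hr' : ∀ x, r x = r' x := fun _ => rfl
  refine (r'.hasFDerivAt.comp_hasDerivAt t (h1.smul hd)).congr_deriv ?_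
  simp only [hr', hh, hN, add_apply, sub_apply, smul_apply, one_apply_eq_self, hsmul, map_add,
    map_sub, map_neg, map_smul]
  module

end Orbit

section Existence

/-- The real part of a function in `L²(0,1)`. -/
noncomputable def rePart : Lp ℂ 2 unitMeasure →L[ℝ] L2 := RCLike.reCLM.compLpL 2 unitMeasure

theorem coeFn_rePart (f : Lp ℂ 2 unitMeasure) : rePart f =ᵐ[unitMeasure] fun x => (f x).re :=
  ContinuousLinearMap.coeFn_compLpL _ f

theorem exists_rePart_eq (f : L2) : ∃ g : Lp ℂ 2 unitMeasure, rePart g = f := by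
  refine ⟨RCLike.ofRealCLM.compLpL 2 unitMeasure f, Lp.ext ?_⟩
  filter_upwards [coeFn_rePart (RCLike.ofRealCLM.compLpL 2 unitMeasure f),
    ContinuousLinearMap.coeFn_compLpL (p := 2) (μ := unitMeasure) (RCLike.ofRealCLM (K := ℂ)) f]
    with x h1 h2
  rw [h1, h2]
  simp

theorem rePart_smul_unitFun (b : ℂ) : rePart (b • unitFun ℂ) = b.re • unitFun ℝ := by
  refine Lp.ext ?_
  filter_upwards [coeFn_rePart (b • unitFun ℂ), Lp.coeFn_smul b (unitFun ℂ),
    Lp.coeFn_smul b.re (unitFun ℝ), coeFn_unitFun (𝕜 := ℂ), coeFn_unitFun (𝕜 := ℝ)]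
    with x h1 h2 h3 h4 h5
  rw [h1, h2, h3, Pi.smul_apply, Pi.smul_apply, h4, h5]
  simp

theorem intervalIntegral_rePart (f : Lp ℂ 2 unitMeasure) {x : ℝ} (hx : x ∈ Icc (0 : ℝ) 1) :
    ∫ y in (0 : ℝ)..x, rePart f y = (∫ y in (0 : ℝ)..x, f y).re := by
  rw [intervalIntegral_congr_unitMeasure (coeFn_rePart f) hx]
  exact (RCLike.reCLM (K := ℂ)).intervalIntegral_comp_comm
    (intervalIntegrable_of_L2 f (by simp) hx)

theorem rePart_volterra (f : Lp ℂ 2 unitMeasure) :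
    rePart (volterra ℂ f) = volterra ℝ (rePart f) := by
  refine Lp.ext ?_
  filter_upwards [coeFn_rePart (volterra ℂ f), coeFn_volterra f, coeFn_volterra (rePart f),
    ae_restrict_mem measurableSet_Icc] with x h1 h2 h3 hx
  rw [h1, h2, h3, intervalIntegral_rePart f hx]

theorem inner_unitFun_rePart (f : Lp ℂ 2 unitMeasure) :
    inner ℝ (unitFun ℝ) (rePart f) = (inner ℂ (unitFun ℂ) f).re := by
  rw [inner_unitFun, inner_unitFun, intervalIntegral_rePart f (by simp)]

theorem volterra_add_star : volterra ℂ + star (volterra ℂ) = rankOneProj (unitFun ℂ) := by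
  ext1 f
  refine ext_inner_left ℂ fun g => ?_
  rw [add_apply, inner_add_right, ContinuousLinearMap.star_eq_adjoint,
    ContinuousLinearMap.adjoint_inner_right, rankOneProj_apply, inner_smul_right, add_comm,
    inner_volterra_add, mul_comm]

theorem rePart_ofReal_smul (a : ℝ) (f : Lp ℂ 2 unitMeasure) :
    rePart ((a : ℂ) • f) = a • rePart f := by
  refine Lp.ext ?_
  filter_upwards [coeFn_rePart ((a : ℂ) • f), Lp.coeFn_smul (a : ℂ) f, Lp.coeFn_smul a (rePart f),
    coeFn_rePart f] with x h1 h2 h3 h4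
  rw [h1, h2, h3, Pi.smul_apply, Pi.smul_apply, h4, smul_eq_mul, Complex.re_ofReal_mul, smul_eq_mul]

variable {ρ α β γ κ : ℝ}

/-- Existence of solutions of the parabolic-elliptic system. -/
theorem exists_isSolution (hγ : 0 < γ) (hκ : 0 < κ) (w₀ : L2) :
    ∃ w v : ℝ → L2, IsSolution ρ α β γ 0 κ w v ∧ w 0 = w₀ := by
  obtain ⟨W₀, rfl⟩ := exists_rePart_eq w₀
  obtain ⟨R, W, hRe, hWc, hW0, hWt⟩ := exists_orbit (norm_unitFun (𝕜 := ℂ)) volterra_add_star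
    volterra_injective hγ hκ ρ (α * β) (rePart : Lp ℂ 2 unitMeasure →+ L2) rePart.continuous
    rePart_ofReal_smul W₀
  refine ⟨fun t => rePart (W t), fun t => β • rePart (R (W t)), ⟨?_, ?_, ?_⟩, ?_⟩
  · exact rePart.continuous.comp_continuousOn hWc
  · intro t ht
    obtain ⟨h, hh, hd⟩ := hWt t ht
    -- The value at `x = 0` is the one for which `u 1 = κ⁻¹ ⟪1, rePart h⟫`, while `u₁ 1 = -⟪1,
    -- rePart h⟫`: the Robin condition.
    obtain ⟨u, u₁, hu, hu1, hu2, hu3, hu4⟩ := exists_isH2 (-rePart h) 0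
      ((κ⁻¹ : ℂ) * inner ℂ (unitFun ℂ) h + inner ℂ (unitFun ℂ) (volterra ℂ h)).re
    refine ⟨-rePart h, u, u₁, ?_, hu1, ?_, ?_⟩
    · convert hu using 1
      rw [hh, map_sub, rePart_smul_unitFun, rePart_volterra, rePart_volterra]
      simp only [zero_smul, zero_add, map_neg]
      abel
    · rw [hu3, hu4]
      simp only [zero_smul, zero_add, map_neg, inner_neg_right]
      rw [← rePart_volterra, inner_unitFun_rePart, inner_unitFun_rePart, Complex.add_re,
        ← Complex.ofReal_inv, Complex.re_ofReal_mul]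
      field_simp
      ring
    · refine hd.congr_deriv ?_
      rw [smul_zero, sub_zero, smul_smul]
      rfl
  · intro t _
    obtain ⟨q, b, hq, hb, hqe⟩ := hRe (W t)
    obtain ⟨u, u₁, hu, hu1, hu2, hu3, hu4⟩ := exists_isH2 (β • rePart q) 0 (β * b.re)
    refine ⟨β • rePart q, u, u₁, ?_, hu1, ?_, ?_⟩
    · convert hu using 1
      rw [hb, map_add, rePart_smul_unitFun, rePart_volterra, rePart_volterra]
      simp only [zero_smul, zero_add, map_smul]
      module
    -- The Neumann condition at `x = 1` is exactly that `q` has mean zero.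
    · rw [hu3, real_inner_smul_right, inner_unitFun_rePart, hq]
      simp
    · have h2 := congrArg rePart hqe
      rw [rePart_ofReal_smul, map_add] at h2
      rw [smul_comm γ β, h2]
      module
  · simp only [hW0]

theorem wellPosed (hγ : 0 < γ) (hκ : 0 < κ) : WellPosed ρ α β γ 0 κ := by
  intro w₀
  obtain ⟨w, v, h, h0⟩ := exists_isSolution (ρ := ρ) (α := α) (β := β) hγ hκ w₀
  refine ⟨w, v, h, h0, fun w' v' h' h0' t ht => ?_⟩
  exact h'.unique h hγ hκ.le (h0'.trans h0.symm) ht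

theorem exponentiallyStable (hγ : 0 < γ) (hκ : 0 < κ) (hρ : |α| * |β| / γ < ρ) :
    ExponentiallyStable ρ α β γ 0 κ := by
  refine ⟨wellPosed hγ hκ, 1 + |β| / γ, ρ - |α| * |β| / γ, by positivity, sub_pos.2 hρ,
    fun w v h t ht => ?_⟩
  have h1 := h.norm_le hγ hκ.le ht
  have h2 := h.norm_elliptic_le hγ ht
  calc ‖w t‖ + ‖v t‖ ≤ (1 + |β| / γ) * ‖w t‖ := by linarith
    _ ≤ (1 + |β| / γ) * (Real.exp (-(ρ - |α| * |β| / γ) * t) * ‖w 0‖) := by gcongr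
    _ = _ := by ring

end Existence

end ParabolicElliptic

theorem mainTheorem7 (ρ α β γ o₂ : ℝ) (hγ : 0 < γ) (ho₂ : 0 < o₂) :
    (o₂ + ρ >
        |α| * |β| / γ *
          (1 + ParabolicElliptic.inducedNorm (ParabolicElliptic.kernelK o₂)) *
          (1 + ParabolicElliptic.inducedNorm (ParabolicElliptic.kernelL o₂)) +
        ((1 + ParabolicElliptic.inducedNorm (ParabolicElliptic.kernelL o₂)) ^ 2 *
          ParabolicElliptic.normKx o₂ ^ 2 + 2) / 2 →
      ParabolicElliptic.ExponentiallyStable ρ α β γ 0 (-ParabolicElliptic.kernelK o₂ 1 1)) ∧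
    (o₂ + ρ >
        (|α| * |β| / γ + ParabolicElliptic.normKx o₂ ^ 2 / 2) *
          (1 + Real.sqrt (o₂ * Real.pi / 2) *
            Real.sqrt (ParabolicElliptic.erfi (Real.sqrt (o₂ / 2))) *
            Real.sqrt (ParabolicElliptic.erf (Real.sqrt (o₂ / 2)))) ^ 2 + 1 →
      ParabolicElliptic.ExponentiallyStable ρ α β γ 0 (-ParabolicElliptic.kernelK o₂ 1 1)) := by
  have hκ : 0 < -ParabolicElliptic.kernelK o₂ 1 1 := by
    rw [ParabolicElliptic.kernelK_diag]; linarith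
  have hc := ParabolicElliptic.le_one_add_normKx_sq ho₂
  have hA : 0 ≤ |α| * |β| / γ := by positivity
  have hn : 0 ≤ ParabolicElliptic.normKx o₂ ^ 2 := sq_nonneg _
  refine ⟨fun h => ParabolicElliptic.exponentiallyStable hγ hκ ?_,
    fun h => ParabolicElliptic.exponentiallyStable hγ hκ ?_⟩
  -- Of the induced norms only nonnegativity is needed: replacing each factor by 1 weakens the
  -- hypothesis, and `hc` then absorbs `o₂`.
  · have hK := ParabolicElliptic.inducedNorm_nonneg (ParabolicElliptic.kernelK o₂)
    have hL := ParabolicElliptic.inducedNorm_nonneg (ParabolicElliptic.kernelL o₂)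
    have h1 : |α| * |β| / γ ≤ |α| * |β| / γ *
        (1 + ParabolicElliptic.inducedNorm (ParabolicElliptic.kernelK o₂)) *
        (1 + ParabolicElliptic.inducedNorm (ParabolicElliptic.kernelL o₂)) := by
      rw [mul_assoc]
      exact le_mul_of_one_le_right hA (one_le_mul_of_one_le_of_one_le (by linarith) (by linarith))
    have h2 : ParabolicElliptic.normKx o₂ ^ 2 ≤
        (1 + ParabolicElliptic.inducedNorm (ParabolicElliptic.kernelL o₂)) ^ 2 *
          ParabolicElliptic.normKx o₂ ^ 2 :=
      le_mul_of_one_le_left hn (one_le_pow₀ (by linarith))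
    linarith
  · have h1 : |α| * |β| / γ + ParabolicElliptic.normKx o₂ ^ 2 / 2 ≤
        (|α| * |β| / γ + ParabolicElliptic.normKx o₂ ^ 2 / 2) *
          (1 + Real.sqrt (o₂ * Real.pi / 2) *
            Real.sqrt (ParabolicElliptic.erfi (Real.sqrt (o₂ / 2))) *
            Real.sqrt (ParabolicElliptic.erf (Real.sqrt (o₂ / 2)))) ^ 2 :=
      le_mul_of_one_le_right (by positivity) (one_le_pow₀ (le_add_of_nonneg_right (by positivity)))
    linarith
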